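/- For integers $q\ge 2$ and $p\ge 1$ let $\zeta(q,p)=\sum_{n>m>0} n^{-q}m^{-p}$ be the double zeta value of weight $q+p$, and for $j\ge 2$ let $\zeta(j)=\sum_{m\ge 1} m^{-j}$. For an integer $k\ge 2$ let $\mathcal{DZ}_k\subset\mathbb{R}$ be the $\mathbb{Q}$-vector space spanned by all double zeta values of weight $k$, let $\mathcal{PZ}_k\subset\mathbb{R}$ be the $\mathbb{Q}$-vector space spanned by $\zeta(k)$ and the products $\zeta(j)\zeta(k-j)$ with $2\le j\le k-2$, and let $\mathcal{DM}_k=\mathcal{DZ}_k/(\mathcal{DZ}_k\cap\mathcal{PZ}_k)$. (For $k\ge 3$ one has $\mathcal{PZ}_k\subset\mathcal{DZ}_k$, so that $\mathcal{DM}_k=\mathcal{DZ}_k/\mathcal{PZ}_k$.) Theorem. Let $k\ge 2$ be even. For every choice of $\varepsilon_1,\ldots,\varepsilon_{[(k-2)/6]}\in\{0,1\}$, the classes of the $[(k-2)/6]$ double zeta values $\zeta(2j+\varepsilon_j,\,k-2j-\varepsilon_j)$, $1\le j\le [(k-2)/6]$, generate the $\mathbb{Q}$-vector space $\mathcal{DM}_k$.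 Consequently $\dim_{\mathbb{Q}}\mathcal{DM}_k\le [(k-2)/6]$. (Here $[x]$ denotes the greatest integer not exceeding $x$.) -/

import Mathlib

/-- The zeta value `ζ(j) = ∑_{m ≥ 1} 1 / m ^ j`, for `j ≥ 2`. -/
noncomputable def zetaValue (j : ℕ) : ℝ :=
  ∑' m : {m : ℕ // 0 < m}, 1 / ((m : ℕ) : ℝ) ^ j

/-- The double zeta value `ζ(q, p) = ∑_{n > m > 0} 1 / (n ^ q * m ^ p)`, for `q ≥ 2`, `p ≥ 1`
(the unordered sum of a convergent series of positive terms). -/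
noncomputable def doubleZeta (q p : ℕ) : ℝ :=
  ∑' x : {x : ℕ × ℕ // 0 < x.2 ∧ x.2 < x.1}, 1 / ((x.1.1 : ℝ) ^ q * (x.1.2 : ℝ) ^ p)

/-- `DZ_k`: the `ℚ`-subspace of `ℝ` spanned by the double zeta values of weight `k`. -/
noncomputable def DZ (k : ℕ) : Submodule ℚ ℝ :=
  Submodule.span ℚ {x : ℝ | ∃ q p : ℕ, 2 ≤ q ∧ 1 ≤ p ∧ q + p = k ∧ x = doubleZeta q p}

/-- `PZ_k`: the `ℚ`-subspace of `ℝ` spanned by `ζ(k)` and the products `ζ(j) ζ(k - j)`,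
`2 ≤ j ≤ k - 2`. -/
noncomputable def PZ (k : ℕ) : Submodule ℚ ℝ :=
  Submodule.span ℚ
    ({zetaValue k} ∪ {x : ℝ | ∃ j : ℕ, 2 ≤ j ∧ j + 2 ≤ k ∧ x = zetaValue j * zetaValue (k - j)})

/-- `DM_k`: the quotient of `DZ_k` by (those of its elements that lie in) `PZ_k`. -/
abbrev DM (k : ℕ) : Type :=
  DZ k ⧸ (PZ k).submoduleOf (DZ k)

theorem doubleZeta_mem_DZ {k q p : ℕ} (hq : 2 ≤ q) (hp : 1 ≤ p) (h : q + p = k) :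
    doubleZeta q p ∈ DZ k :=
  Submodule.subset_span ⟨q, p, hq, hp, h, rfl⟩

/-- The class of the double zeta value `ζ(q, p)` of weight `k` in `DM_k`. -/
noncomputable def dmClass (k q p : ℕ) (hq : 2 ≤ q) (hp : 1 ≤ p) (h : q + p = k) : DM k :=
  Submodule.Quotient.mk ⟨doubleZeta q p, doubleZeta_mem_DZ hq hp h⟩

/-! Put d = k - 2. By duality it suffices that a `ℚ`-linear ψ : ℝ → ℚ killing `PZ k` and the chosen
values kills every double zeta value of weight k. Let a_i = ψ(ζ(i+1, d-i+1)) for 1 ≤ i ≤ d, a_0 =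
-a_d, and P = ∑ a_i X^i. Stuffle products give a_{d-i} = -a_i. Shuffle products, together with the
sum formula for the two boundary relations, give P(1-X) = -P(X).

These symmetries leave little room. Oddness about 1/2 forces odd degree and a nonzero subleading
coefficient; reversed, the two lowest nonzero coefficients sit at 2j-1 and 2j for some j. Killing
either one for each j ≤ n = [d/6] pushes the order of P at 0 to at least 2n+1, hence also at 1, and
its degree down to d-2n-1 or less. P vanishes at -1 and 2 as well, so a nonzero P would have degree
at least 4n+4 > d-2n-1 (`eq_zero_of_antisymm`). -/

/-! ### Partial fractions -/

open Finset in
theorem choose_sum_succ_succ {K : Type*} [Field K] (w y : K) (u v : ℕ) :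
    ∑ i ∈ range (u + 1 + (v + 1) + 1),
        ((i.choose (u + 1) : ℕ) : K) * (w ^ (i + 1) * y ^ (u + 1 + (v + 1) - i + 1)) =
      w * (∑ i ∈ range (u + (v + 1) + 1),
          ((i.choose u : ℕ) : K) * (w ^ (i + 1) * y ^ (u + (v + 1) - i + 1)) +
        ∑ i ∈ range (u + 1 + v + 1),
          ((i.choose (u + 1) : ℕ) : K) * (w ^ (i + 1) * y ^ (u + 1 + v - i + 1))) := by
  rw [show u + (v + 1) + 1 = u + v + 2 by ring, show u + 1 + v + 1 = u + v + 2 by ring,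
    show u + 1 + (v + 1) + 1 = u + v + 2 + 1 by ring, sum_range_succ', ← sum_add_distrib, mul_sum]
  simp only [Nat.choose_zero_succ, Nat.cast_zero, zero_mul, add_zero]
  refine sum_congr rfl fun i _ => ?_
  rw [Nat.choose_succ_succ, show u + 1 + (v + 1) - (i + 1) = u + v + 1 - i by omega,
    show u + (v + 1) - i = u + v + 1 - i by omega, show u + 1 + v - i = u + v + 1 - i by omega]
  push_cast
  ring

open Finset in
theorem sum_pow_mul_pow_succ {K : Type*} [Field K] (w y : K) (v : ℕ) :
    ∑ i ∈ range (v + 1 + 1), w ^ (i + 1) * y ^ (v + 1 - i + 1) =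
      w * (y ^ (v + 2) + ∑ i ∈ range (v + 1), w ^ (i + 1) * y ^ (v - i + 1)) := by
  rw [sum_range_succ', mul_add, mul_sum, add_comm]
  congr 1
  · simp
  · refine sum_congr rfl fun i _ => ?_
    rw [show v + 1 - (i + 1) = v - i by omega]
    ring

open Finset in
theorem sum_choose_self_range {K : Type*} [Field K] (g : ℕ → K) (u : ℕ) :
    ∑ i ∈ range (u + 1), ((i.choose u : ℕ) : K) * g i = g u := by
  rw [sum_range_succ, sum_eq_zero, zero_add, Nat.choose_self, Nat.cast_one, one_mul]
  intro i hi
  rw [Nat.choose_eq_zero_of_lt (mem_range.mp hi), Nat.cast_zero, zero_mul]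

open Finset in
/-- The partial fraction decomposition of `1 / (x ^ r * y ^ s)`, in terms of the inverses. -/
theorem pow_mul_pow_eq_sum_choose {K : Type*} [Field K] {w x y : K} (h : x * y = w * (x + y)) :
    ∀ u v : ℕ, x ^ (u + 1) * y ^ (v + 1) =
      ∑ i ∈ range (u + v + 1), ((i.choose u : ℕ) : K) * (w ^ (i + 1) * y ^ (u + v - i + 1)) +
      ∑ i ∈ range (v + u + 1), ((i.choose v : ℕ) : K) * (w ^ (i + 1) * x ^ (v + u - i + 1))
  | 0, 0 => by simp [h]; ring
  | u + 1, 0 => by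
    have ih := pow_mul_pow_eq_sum_choose h u 0
    simp only [add_zero, zero_add, Nat.choose_zero_right, Nat.cast_one, one_mul,
      sum_choose_self_range, sum_pow_mul_pow_succ] at ih ⊢
    simp only [Nat.sub_self, zero_add] at ih ⊢
    linear_combination w * ih + x ^ (u + 1) * h
  | 0, v + 1 => by
    have ih := pow_mul_pow_eq_sum_choose h 0 v
    simp only [add_zero, zero_add, Nat.choose_zero_right, Nat.cast_one, one_mul,
      sum_choose_self_range, sum_pow_mul_pow_succ] at ih ⊢
    simp only [Nat.sub_self, zero_add] at ih ⊢
    linear_combination w * ih + y ^ (v + 1) * h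
  | u + 1, v + 1 => by
    have ih₁ := pow_mul_pow_eq_sum_choose h u (v + 1)
    have ih₂ := pow_mul_pow_eq_sum_choose h (u + 1) v
    rw [choose_sum_succ_succ, choose_sum_succ_succ]
    linear_combination w * ih₁ + w * ih₂ + x ^ (u + 1) * y ^ (v + 1) * h

/-! ### Convergence, and series over free indices -/

theorem summable_one_div_succ_pow {r : ℕ} (hr : 2 ≤ r) :
    Summable fun n : ℕ => 1 / ((n : ℝ) + 1) ^ r := by
  have := (summable_nat_add_iff 1).mpr (Real.summable_one_div_nat_pow.mpr (by omega : 1 < r))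
  simpa using this

theorem hasSum_zetaValue {r : ℕ} (hr : 2 ≤ r) :
    HasSum (fun n : ℕ => 1 / ((n : ℝ) + 1) ^ r) (zetaValue r) := by
  have h : zetaValue r = ∑' n : ℕ, 1 / ((n : ℝ) + 1) ^ r := by
    change ∑' m : ℕ+, 1 / ((m : ℕ) : ℝ) ^ r = _
    rw [← Equiv.pnatEquivNat.symm.tsum_eq]
    refine tsum_congr fun n => ?_
    simp
  rw [h]
  exact (summable_one_div_succ_pow hr).hasSum

theorem summable_doubleZeta {q p : ℕ} (hq : 2 ≤ q) (hp : 1 ≤ p) :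
    Summable fun x : ℕ × ℕ =>
      1 / (((x.1 : ℝ) + x.2 + 2) ^ q * ((x.2 : ℝ) + 1) ^ p) := by
  have h : Summable fun n : ℕ => 1 / ((n : ℝ) + 1) ^ (3 / 2 : ℝ) := by
    have := (summable_nat_add_iff 1).mpr
      (Real.summable_one_div_nat_rpow.mpr (by norm_num : (1 : ℝ) < 3 / 2))
    simpa using this
  -- With n = a+b+2 and m = b+1, the worst case n²m dominates (a+1)^(3/2) (b+1)^(3/2): half a power
  -- of n is traded for one of m.
  refine Summable.of_nonneg_of_le (fun x => by positivity) (fun x => ?_)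
    (h.mul_of_nonneg h (fun n => by positivity) (fun n => by positivity))
  rw [one_div_mul_one_div]
  have ha : (0 : ℝ) ≤ x.1 := by positivity
  have hb : (0 : ℝ) ≤ x.2 := by positivity
  refine one_div_le_one_div_of_le (by positivity) ?_
  calc ((x.1 : ℝ) + 1) ^ (3 / 2 : ℝ) * ((x.2 : ℝ) + 1) ^ (3 / 2 : ℝ)
      = ((x.1 : ℝ) + 1) ^ (3 / 2 : ℝ) * (((x.2 : ℝ) + 1) ^ (1 / 2 : ℝ) * ((x.2 : ℝ) + 1)) := by
        rw [← Real.rpow_add_one (by positivity)]; norm_num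
    _ ≤ ((x.1 : ℝ) + x.2 + 2) ^ (3 / 2 : ℝ) *
          (((x.1 : ℝ) + x.2 + 2) ^ (1 / 2 : ℝ) * ((x.2 : ℝ) + 1)) := by
        gcongr <;> linarith
    _ = ((x.1 : ℝ) + x.2 + 2) ^ 2 * ((x.2 : ℝ) + 1) ^ 1 := by
        rw [← mul_assoc, ← Real.rpow_add (by positivity), pow_one]; norm_num
    _ ≤ _ := by
        gcongr <;> linarith

/-- Pairs `n > m > 0`, parametrized by `(n - m - 1, m - 1)`. -/
def decreasingPairEquiv : ℕ × ℕ ≃ {x : ℕ × ℕ // 0 < x.2 ∧ x.2 < x.1} where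
  toFun x := ⟨(x.1 + x.2 + 2, x.2 + 1), by dsimp only; omega⟩
  invFun x := (x.1.1 - x.1.2 - 1, x.1.2 - 1)
  left_inv x := by ext <;> dsimp only <;> omega
  right_inv x := by
    obtain ⟨⟨n, m⟩, h⟩ := x
    simp only [Subtype.mk.injEq, Prod.mk.injEq] at h ⊢
    omega

theorem hasSum_doubleZeta {q p : ℕ} (hq : 2 ≤ q) (hp : 1 ≤ p) :
    HasSum (fun x : ℕ × ℕ => 1 / (((x.1 : ℝ) + x.2 + 2) ^ q * ((x.2 : ℝ) + 1) ^ p))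
      (doubleZeta q p) := by
  have h : doubleZeta q p =
      ∑' x : ℕ × ℕ, 1 / (((x.1 : ℝ) + x.2 + 2) ^ q * ((x.2 : ℝ) + 1) ^ p) := by
    rw [doubleZeta, ← decreasingPairEquiv.tsum_eq]
    refine tsum_congr fun x => ?_
    simp [decreasingPairEquiv]
  rw [h]
  exact (summable_doubleZeta hq hp).hasSum

theorem hasSum_doubleZeta_swap {q p : ℕ} (hq : 2 ≤ q) (hp : 1 ≤ p) :
    HasSum (fun x : ℕ × ℕ => 1 / (((x.1 : ℝ) + x.2 + 2) ^ q * ((x.1 : ℝ) + 1) ^ p))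
      (doubleZeta q p) := by
  refine ((Equiv.prodComm ℕ ℕ).hasSum_iff.mpr (hasSum_doubleZeta hq hp)).congr_fun ?_
  intro x
  simp [add_comm (x.1 : ℝ)]

theorem hasSum_zetaValue_mul {r s : ℕ} (hr : 2 ≤ r) (hs : 2 ≤ s) :
    HasSum (fun x : ℕ × ℕ => 1 / (((x.1 : ℝ) + 1) ^ r * ((x.2 : ℝ) + 1) ^ s))
      (zetaValue r * zetaValue s) := by
  have h := (hasSum_zetaValue hr).mul (hasSum_zetaValue hs)
    ((summable_one_div_succ_pow hr).mul_of_nonneg (summable_one_div_succ_pow hs)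
      (fun n => by positivity) (fun n => by positivity))
  simpa only [one_div_mul_one_div] using h

/-! ### Splitting along the diagonal, and the stuffle product -/

theorem injective_above_diagonal : Function.Injective fun x : ℕ × ℕ => (x.1 + x.2 + 1, x.2) := by
  rintro ⟨a, b⟩ ⟨c, d⟩ h
  simp only [Prod.mk.injEq] at h ⊢
  omega

theorem injective_below_diagonal : Function.Injective fun x : ℕ × ℕ => (x.2, x.1 + x.2 + 1) := by
  rintro ⟨a, b⟩ ⟨c, d⟩ h
  simp only [Prod.mk.injEq] at h ⊢
  omega

theorem injective_diagonal : Function.Injective fun n : ℕ => (n, n) := by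
  intro a b h
  simpa using h

theorem range_above_diagonal :
    Set.range (fun x : ℕ × ℕ => (x.1 + x.2 + 1, x.2)) = {x : ℕ × ℕ | x.2 < x.1} := by
  ext ⟨a, b⟩
  simp only [Set.mem_range, Prod.exists, Prod.mk.injEq, Set.mem_ofPred_eq]
  exact ⟨by rintro ⟨c, d, h⟩; omega, fun h => ⟨a - b - 1, b, by omega, rfl⟩⟩

theorem range_below_diagonal :
    Set.range (fun x : ℕ × ℕ => (x.2, x.1 + x.2 + 1)) = {x : ℕ × ℕ | x.1 < x.2} := by
  ext ⟨a, b⟩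
  simp only [Set.mem_range, Prod.exists, Prod.mk.injEq, Set.mem_ofPred_eq]
  exact ⟨by rintro ⟨c, d, h⟩; omega, fun h => ⟨b - a - 1, a, rfl, by omega⟩⟩

theorem range_diagonal : Set.range (fun n : ℕ => (n, n)) = {x : ℕ × ℕ | x.1 = x.2} := by
  ext ⟨a, b⟩
  simp

/-- A sum over `{(n, m) | m ≤ n}` is the sum over `m < n` plus the sum over the diagonal. -/
theorem hasSum_le_of_lt_of_diagonal {f : ℕ × ℕ → ℝ} {a c : ℝ}
    (ha : HasSum (fun x : ℕ × ℕ => f (x.1 + x.2 + 1, x.2)) a)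
    (hc : HasSum (fun n : ℕ => f (n, n)) c) :
    HasSum (fun x : {x : ℕ × ℕ | x.2 ≤ x.1} => f x) (a + c) := by
  have h₁ := injective_above_diagonal.hasSum_range_iff (f := f) |>.mpr ha
  have h₂ := injective_diagonal.hasSum_range_iff (f := f) |>.mpr hc
  rw [range_above_diagonal] at h₁
  rw [range_diagonal] at h₂
  have h := h₁.add_disjoint (Set.disjoint_left.mpr fun x hx hy => by
    simp only [Set.mem_ofPred_eq] at hx hy; omega) h₂
  rwa [show {x : ℕ × ℕ | x.2 < x.1} ∪ {x | x.1 = x.2} = {x | x.2 ≤ x.1} by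
    ext x; simp only [Set.mem_union, Set.mem_ofPred_eq]; omega] at h

theorem hasSum_of_lt_of_gt_of_diagonal {f : ℕ × ℕ → ℝ} {a b c : ℝ}
    (ha : HasSum (fun x : ℕ × ℕ => f (x.1 + x.2 + 1, x.2)) a)
    (hb : HasSum (fun x : ℕ × ℕ => f (x.2, x.1 + x.2 + 1)) b)
    (hc : HasSum (fun n : ℕ => f (n, n)) c) : HasSum f (a + c + b) := by
  have h₁ := injective_below_diagonal.hasSum_range_iff (f := f) |>.mpr hb
  rw [range_below_diagonal] at h₁
  have h := (hasSum_le_of_lt_of_diagonal ha hc).add_disjoint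
    (Set.disjoint_left.mpr fun x hx hy => by
      simp only [Set.mem_ofPred_eq] at hx hy; omega) h₁
  rw [show {x : ℕ × ℕ | x.2 ≤ x.1} ∪ {x | x.1 < x.2} = Set.univ by
    exact Set.eq_univ_of_forall fun x => le_or_gt x.2 x.1] at h
  simpa only [Set.indicator_univ] using hasSum_subtype_iff_indicator.mp h

/-- The stuffle product of two zeta values. -/
theorem zetaValue_mul_eq_stuffle {r s : ℕ} (hr : 2 ≤ r) (hs : 2 ≤ s) :
    zetaValue r * zetaValue s = doubleZeta r s + doubleZeta s r + zetaValue (r + s) := by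
  have h := hasSum_of_lt_of_gt_of_diagonal
    (f := fun x : ℕ × ℕ => 1 / (((x.1 : ℝ) + 1) ^ r * ((x.2 : ℝ) + 1) ^ s))
    (a := doubleZeta r s) (b := doubleZeta s r) (c := zetaValue (r + s))
    (by simpa only [Nat.cast_add, Nat.cast_one, add_assoc, one_add_one_eq_two] using
      hasSum_doubleZeta hr (by omega : 1 ≤ s))
    (by simpa only [Nat.cast_add, Nat.cast_one, add_assoc, one_add_one_eq_two, mul_comm] using
      hasSum_doubleZeta hs (by omega : 1 ≤ r))
    (by simpa only [pow_add] using hasSum_zetaValue (by omega : 2 ≤ r + s))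
  rw [(hasSum_zetaValue_mul hr hs).unique h, add_right_comm]

/-! ### The shuffle product -/

open Finset in
/-- The shuffle product of two zeta values. -/
theorem zetaValue_mul_eq_shuffle {u v : ℕ} (hu : 1 ≤ u) (hv : 1 ≤ v) :
    zetaValue (u + 1) * zetaValue (v + 1) = ∑ i ∈ range (u + v + 1),
      (((i.choose u : ℕ) : ℝ) + ((i.choose v : ℕ) : ℝ)) * doubleZeta (i + 1) (u + v - i + 1) := by
  -- At i = 0 the double series would diverge, but its binomial coefficient is zero.
  have key {u' : ℕ} (hu' : 1 ≤ u') {i p : ℕ} {f : ℕ × ℕ → ℝ}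
      (hf : 2 ≤ i + 1 → HasSum f (doubleZeta (i + 1) p)) :
      HasSum (fun x => ((i.choose u' : ℕ) : ℝ) * f x)
        (((i.choose u' : ℕ) : ℝ) * doubleZeta (i + 1) p) := by
    rcases Nat.eq_zero_or_pos i with rfl | hi
    · simp [Nat.choose_eq_zero_of_lt hu', hasSum_zero]
    · exact (hf (by omega)).mul_left _
  have h₁ := hasSum_sum fun i (_ : i ∈ range (u + v + 1)) =>
    key hu (i := i) (p := u + v - i + 1) fun hi => hasSum_doubleZeta hi (by omega)
  have h₂ := hasSum_sum fun i (_ : i ∈ range (v + u + 1)) =>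
    key hv (i := i) (p := v + u - i + 1) fun hi => hasSum_doubleZeta_swap hi (by omega)
  have h := h₁.add h₂
  simp only [add_mul, sum_add_distrib]
  rw [add_comm v u] at h
  refine (hasSum_zetaValue_mul (by omega) (by omega)).unique (h.congr_fun ?_)
  intro x
  have hx : (1 / ((x.1 : ℝ) + 1)) * (1 / ((x.2 : ℝ) + 1)) =
      1 / ((x.1 : ℝ) + x.2 + 2) * (1 / ((x.1 : ℝ) + 1) + 1 / ((x.2 : ℝ) + 1)) := by
    field_simp
    ring
  have := pow_mul_pow_eq_sum_choose hx u v
  rw [add_comm v u] at this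
  simpa only [one_div_pow, one_div_mul_one_div] using this

/-! ### The sum formula -/

open Finset in
theorem hasSum_one_div_mul_add (m : ℕ) :
    HasSum (fun d : ℕ => 1 / ((d : ℝ) + 1) - 1 / ((d : ℝ) + m + 1))
      (∑ i ∈ range m, 1 / ((i : ℝ) + 1)) := by
  induction m with
  | zero => simp [hasSum_zero]
  | succ m ih =>
    rw [sum_range_succ]
    have h : HasSum (fun d : ℕ => 1 / ((d : ℝ) + m + 1) - 1 / ((d : ℝ) + m + 2))
        (1 / ((m : ℝ) + 1)) := by
      rw [hasSum_iff_tendsto_nat_of_nonneg fun d =>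
        sub_nonneg.mpr (one_div_le_one_div_of_le (by positivity) (by linarith))]
      have e (n : ℕ) : ∑ d ∈ range n, (1 / ((d : ℝ) + m + 1) - 1 / ((d : ℝ) + m + 2)) =
          1 / ((m : ℝ) + 1) - 1 / ((n : ℝ) + m + 1) := by
        have := sum_range_sub' (fun d : ℕ => 1 / ((d : ℝ) + m + 1)) n
        simp only [Nat.cast_zero, zero_add] at this
        rw [← this]
        refine sum_congr rfl fun d _ => ?_
        push_cast
        ring
      simp only [e]
      have ht : Filter.Tendsto (fun n : ℕ => 1 / ((n : ℝ) + m + 1)) Filter.atTop (nhds 0) := by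
        have := (Filter.tendsto_add_atTop_iff_nat m).mpr
          (tendsto_one_div_add_atTop_nhds_zero_nat (𝕜 := ℝ))
        simpa using this
      simpa using tendsto_const_nhds.sub ht
    convert ih.add h using 2 with d
    push_cast
    ring

-- With n = a+b+2 and m = b+1, the sum is geometric in 1/n and 1/m, and the added term cancels one
-- end of it. What remains telescopes over n to a harmonic number over m^(d+1).
open Finset in
theorem sum_one_div_pow_mul_pow_add {a b : ℝ} (ha : 0 ≤ a) (hb : 0 ≤ b) (d : ℕ) :
    ∑ i ∈ range d, 1 / ((a + b + 2) ^ (i + 2) * (b + 1) ^ (d - i)) +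
        1 / ((a + b + 2) ^ (d + 1) * (a + 1) ^ 1) =
      1 / (b + 1) ^ (d + 1) * (1 / (a + 1) - 1 / (a + b + 2)) := by
  have hg := (Commute.all (1 / (a + b + 2)) (1 / (b + 1))).geom_sum₂_mul d
  have hs : ∑ i ∈ range d, 1 / ((a + b + 2) ^ (i + 2) * (b + 1) ^ (d - i)) =
      (1 / (a + b + 2)) ^ 2 * (1 / (b + 1)) *
        ∑ i ∈ range d, (1 / (a + b + 2)) ^ i * (1 / (b + 1)) ^ (d - 1 - i) := by
    rw [mul_sum]
    refine sum_congr rfl fun i hi => ?_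
    obtain ⟨j, rfl⟩ := Nat.exists_eq_add_of_lt (mem_range.mp hi)
    rw [show i + j + 1 - i = j + 1 by omega, show i + j + 1 - 1 - i = j by omega,
      ← one_div_mul_one_div, ← one_div_pow, ← one_div_pow]
    ring
  have h₀ : 1 / (a + b + 2) - 1 / (b + 1) = -((a + 1) * (1 / (a + b + 2)) * (1 / (b + 1))) := by
    field_simp
    ring
  have h₁ : 1 / (a + 1) - 1 / (a + b + 2) = (b + 1) * (1 / (a + b + 2)) * (1 / (a + 1)) := by
    field_simp
    ring
  have h₂ : (1 / (a + 1)) * (a + 1) = 1 := one_div_mul_cancel (by positivity)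
  have h₃ : (1 / (b + 1)) * (b + 1) = 1 := one_div_mul_cancel (by positivity)
  rw [hs, h₁, pow_one, ← one_div_mul_one_div, ← one_div_pow, ← one_div_pow]
  rw [h₀] at hg
  generalize 1 / (a + b + 2) = w at *
  generalize 1 / (b + 1) = y at *
  generalize 1 / (a + 1) = x at *
  generalize ∑ i ∈ range d, w ^ i * y ^ (d - 1 - i) = S at *
  linear_combination -w * x * hg - w ^ 2 * y * S * h₂ - w * x * y ^ d * h₃

open Finset in
theorem hasSum_sum_range_of_lt_of_diagonal {f : ℕ × ℕ → ℝ} {a c : ℝ}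
    (ha : HasSum (fun x : ℕ × ℕ => f (x.1 + x.2 + 1, x.2)) a)
    (hc : HasSum (fun n : ℕ => f (n, n)) c) :
    HasSum (fun m => ∑ i ∈ range (m + 1), f (m, i)) (a + c) := by
  have h := hasSum_le_of_lt_of_diagonal ha hc
  refine (hasSum_subtype_iff_indicator.mp h).prod_fiberwise fun m => ?_
  have h' := hasSum_sum_of_ne_finset_zero (L := .unconditional ℕ)
    (f := fun i => {x : ℕ × ℕ | x.2 ≤ x.1}.indicator f (m, i)) (s := range (m + 1)) fun i hi =>
      Set.indicator_of_notMem (by simpa using hi) _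
  rwa [sum_congr rfl fun i hi => Set.indicator_of_mem (a := (m, i))
    (Nat.lt_succ_iff.mp (mem_range.mp hi)) f] at h'

open Finset in
theorem hasSum_harmonic_div_pow {d : ℕ} (hd : 1 ≤ d) :
    HasSum (fun m : ℕ => ∑ i ∈ range (m + 1),
      1 / (((m : ℝ) + 1) ^ (d + 1) * ((i : ℝ) + 1) ^ 1))
      (doubleZeta (d + 1) 1 + zetaValue (d + 2)) := by
  have h₁ : HasSum (fun x : ℕ × ℕ => 1 / ((((x.1 + x.2 + 1 : ℕ) : ℝ) + 1) ^ (d + 1) *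
      ((x.2 : ℝ) + 1) ^ 1)) (doubleZeta (d + 1) 1) := by
    simpa only [Nat.cast_add, Nat.cast_one, add_assoc, one_add_one_eq_two] using
      hasSum_doubleZeta (by omega : 2 ≤ d + 1) le_rfl
  have h₂ : HasSum (fun n : ℕ => 1 / (((n : ℝ) + 1) ^ (d + 1) * ((n : ℝ) + 1) ^ 1))
      (zetaValue (d + 2)) := by
    simp only [← pow_add]
    exact hasSum_zetaValue (by omega)
  exact hasSum_sum_range_of_lt_of_diagonal
    (f := fun x : ℕ × ℕ => 1 / (((x.1 : ℝ) + 1) ^ (d + 1) * ((x.2 : ℝ) + 1) ^ 1)) h₁ h₂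

open Finset in
/-- The sum formula for double zeta values. -/
theorem sum_doubleZeta_eq_zetaValue {d : ℕ} (hd : 1 ≤ d) :
    ∑ i ∈ range d, doubleZeta (i + 2) (d - i) = zetaValue (d + 2) := by
  have h₁ := (hasSum_sum fun i (hi : i ∈ range d) =>
    hasSum_doubleZeta (by omega : 2 ≤ i + 2) (by have := mem_range.mp hi; omega : 1 ≤ d - i)).add
    (hasSum_doubleZeta_swap (by omega : 2 ≤ d + 1) le_rfl)
  simp only [sum_one_div_pow_mul_pow_add (Nat.cast_nonneg _) (Nat.cast_nonneg _)] at h₁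
  have h₂ := ((Equiv.prodComm ℕ ℕ).hasSum_iff.mpr h₁).prod_fiberwise
    (g := fun m : ℕ => ∑ i ∈ range (m + 1), 1 / (((m : ℝ) + 1) ^ (d + 1) * ((i : ℝ) + 1) ^ 1))
    fun m => by
      have h := (hasSum_one_div_mul_add (m + 1)).mul_left (1 / ((m : ℝ) + 1) ^ (d + 1))
      simp only [mul_sum, one_div_mul_one_div, Nat.cast_add, Nat.cast_one] at h
      simpa only [pow_one, add_assoc, one_add_one_eq_two, Function.comp_apply,
        Equiv.prodComm_apply, Prod.swap_prod_mk] using h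
  linarith [h₂.unique (hasSum_harmonic_div_pow hd)]

/-! ### Polynomials with the two symmetries -/

section

open Polynomial

/-- A nonzero polynomial which is odd under `x ↦ 1 - x` has odd degree, and its two leading
coefficients do not vanish. -/
theorem odd_natDegree_of_comp_one_sub {P : ℚ[X]} (hP : P ≠ 0) (h : P.comp (1 - X) = -P) :
    Odd P.natDegree ∧ P.coeff (P.natDegree - 1) ≠ 0 := by
  have hlc : P.leadingCoeff ≠ 0 := leadingCoeff_ne_zero.mpr hP
  have hX : (1 - X : ℚ[X]) = C (-1) * X + C 1 := by simp; ring
  have hodd : Odd P.natDegree := by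
    have h' := congrArg leadingCoeff h
    rw [leadingCoeff_comp (by rw [hX, natDegree_linear (by norm_num)]; norm_num), hX,
      leadingCoeff_linear (by norm_num), leadingCoeff_neg] at h'
    by_contra hn
    rw [Nat.not_odd_iff_even] at hn
    rw [hn.neg_one_pow] at h'
    apply hlc
    linarith
  refine ⟨hodd, fun h0 => ?_⟩
  obtain ⟨m, hm⟩ := hodd
  -- An even number of derivatives preserves oddness and reduces to degree one, where a zero
  -- constant term would kill the leading one.
  have hQ : (derivative^[2 * m] P).comp (1 - X) = -derivative^[2 * m] P := by
    have h' := congrArg (fun Q : ℚ[X] => derivative^[2 * m] Q) h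
    simpa [iterate_derivative_comp_one_sub_X, iterate_derivative_neg] using h'
  have hdeg : (derivative^[2 * m] P).natDegree ≤ 1 :=
    (natDegree_iterate_derivative P (2 * m)).trans (by omega)
  have h₀ : (derivative^[2 * m] P).coeff 0 = 0 := by
    rw [hm, Nat.add_sub_cancel] at h0
    rw [coeff_iterate_derivative, zero_add, h0, smul_zero]
  have h₁ := congrArg (eval 0) hQ
  rw [eq_X_add_C_of_natDegree_le_one hdeg, h₀, coeff_iterate_derivative, add_comm 1, ← hm] at h₁
  simp only [map_zero, add_zero, mul_comp, C_comp, X_comp, eval_mul, eval_C, eval_sub, eval_one,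
    eval_X, sub_zero, mul_one, eval_neg, mul_zero, neg_zero, smul_eq_zero, hm] at h₁
  rcases h₁ with h₁ | h₁
  · exact absurd h₁ (Nat.descFactorial_pos.mpr (by omega)).ne'
  · exact hlc (by rw [leadingCoeff, hm]; exact h₁)

/-- A zero count: orders 2n+1 at 0 and 1 and zeros at -1 and 2 need degree 4n+4, while parity
sharpens d ≤ 6n+5 to d ≤ 6n+4 and leaves degree at most 4n+3. -/
theorem eq_zero_of_antisymm {P : ℚ[X]} {d n : ℕ} (hd : Even d) (hdn : d ≤ 6 * n + 5)
    (hdeg : P.natDegree ≤ d)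
    (hanti : ∀ i ≤ d, P.coeff (d - i) = -P.coeff i) (hcomp : P.comp (1 - X) = -P)
    (hvan : ∀ j, 1 ≤ j → j ≤ n → P.coeff (2 * j - 1) = 0 ∨ P.coeff (2 * j) = 0) : P = 0 := by
  by_contra hP
  obtain ⟨hodd, hnext⟩ := odd_natDegree_of_comp_one_sub hP hcomp
  have hlc : P.coeff P.natDegree ≠ 0 := leadingCoeff_ne_zero.mpr hP
  -- Otherwise reversal carries the top two nonzero coefficients onto a pair 2j-1, 2j with j ≤ n.
  have hN : P.natDegree + 2 * n + 1 ≤ d := by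
    by_contra hlt
    obtain ⟨m, hm⟩ := hodd
    obtain ⟨e, he⟩ := hd
    rcases hvan (e - m) (by omega) (by omega) with h | h
    · have := hanti (2 * (e - m) - 1) (by omega)
      rw [show d - (2 * (e - m) - 1) = P.natDegree by omega, h] at this
      exact hlc (by simpa using this)
    · have := hanti (2 * (e - m)) (by omega)
      rw [show d - 2 * (e - m) = P.natDegree - 1 by omega, h] at this
      exact hnext (by simpa using this)
  have hX : X ^ (2 * n + 1) ∣ P := by
    rw [X_pow_dvd_iff]
    intro i hi
    have := hanti i (by omega)
    rw [coeff_eq_zero_of_natDegree_lt (by omega)] at this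
    linarith
  have hX1 : (X - C 1) ^ (2 * n + 1) ∣ P := by
    obtain ⟨Q, hQ⟩ := hX
    have h' := congrArg (fun R => R.comp (1 - X)) hQ
    simp only [hcomp, mul_comp, pow_comp, X_comp] at h'
    rw [← dvd_neg, h']
    refine Dvd.dvd.mul_right (pow_dvd_pow_of_dvd ⟨-1, ?_⟩ _) _
    simp
  have heval (x : ℚ) : P.eval (1 - x) = -P.eval x := by
    simpa using congrArg (eval x) hcomp
  -- As d is even, i and d-i have the same parity, so the antisymmetric terms cancel at -1.
  have hneg : P.eval (-1) = 0 := by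
    have h₁ : P.eval (-1) = ∑ i ∈ Finset.range (d + 1), P.coeff i * (-1) ^ i :=
      eval_eq_sum_range' (by omega) _
    have h₂ : ∑ i ∈ Finset.range (d + 1), P.coeff i * (-1) ^ i =
        -∑ i ∈ Finset.range (d + 1), P.coeff i * (-1) ^ i := by
      conv_lhs => rw [← Finset.sum_range_reflect]
      rw [← Finset.sum_neg_distrib]
      refine Finset.sum_congr rfl fun i hi => ?_
      have hi := Finset.mem_range.mp hi
      rw [show d + 1 - 1 - i = d - i by omega, hanti i (by omega),
        show ((-1 : ℚ)) ^ (d - i) = (-1) ^ i by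
          apply neg_one_pow_congr; rw [Nat.even_sub (by omega)]; tauto]
      ring
    linarith
  have htwo : P.eval 2 = 0 := by
    have := heval (-1)
    norm_num [hneg] at this
    exact this
  have hX2 : X - C 2 ∣ P := dvd_iff_isRoot.mpr htwo
  have c (a b : ℚ) (hab : a ≠ b) : IsCoprime (X - C a) (X - C b) :=
    isCoprime_X_sub_C_of_isUnit_sub (sub_ne_zero.mpr hab).isUnit
  have hXn : X - C (-1) ∣ P := dvd_iff_isRoot.mpr hneg
  have hX0 : (X - C 0) ^ (2 * n + 1) ∣ P := by simpa using hX
  have hprod : (X - C 0) ^ (2 * n + 1) * (X - C 1) ^ (2 * n + 1) * (X - C (-1)) * (X - C 2) ∣ P := by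
    refine IsCoprime.mul_dvd ?_ (IsCoprime.mul_dvd ?_ (IsCoprime.mul_dvd ?_ hX0 hX1) hXn) hX2
    · exact ((((c _ _ (by norm_num)).pow_left).mul_left ((c _ _ (by norm_num)).pow_left)).mul_left
        (c _ _ (by norm_num)))
    · exact ((c _ _ (by norm_num)).pow_left).mul_left ((c _ _ (by norm_num)).pow_left)
    · exact (c _ _ (by norm_num)).pow
  have hle := natDegree_le_of_dvd hprod hP
  have hmonic (a : ℚ) : (X - C a).Monic := monic_X_sub_C a
  have h₀₁ := ((hmonic 0).pow (2 * n + 1)).mul ((hmonic 1).pow (2 * n + 1))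
  rw [(h₀₁.mul (hmonic (-1))).natDegree_mul (hmonic 2), h₀₁.natDegree_mul (hmonic (-1)),
    ((hmonic 0).pow _).natDegree_mul ((hmonic 1).pow _), natDegree_pow, natDegree_pow] at hle
  simp only [natDegree_X_sub_C] at hle
  obtain ⟨e, he⟩ := hd
  omega

/-- Coefficients satisfying the double shuffle relations modulo products give a polynomial
which is odd under `x ↦ 1 - x`. -/
theorem comp_one_sub_eq_neg {d : ℕ} {a : ℕ → ℚ} (hanti : ∀ i ≤ d, a (d - i) = -a i)
    (hsh : ∀ u ≤ d, ∑ i ∈ Finset.range (d + 1),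
      (((i.choose u : ℕ) : ℚ) + ((i.choose (d - u) : ℕ) : ℚ)) * a i = 0) :
    (∑ i ∈ Finset.range (d + 1), C (a i) * X ^ i).comp (1 - X) =
      -∑ i ∈ Finset.range (d + 1), C (a i) * X ^ i := by
  -- Expand (x + (1-x))^i = 1 and multiply by (1-x)^(d-i).
  have hbin (x : ℚ) (i : ℕ) (hi : i ≤ d) : ∑ u ∈ Finset.range (d + 1),
      ((i.choose u : ℕ) : ℚ) * (x ^ u * (1 - x) ^ (d - u)) = (1 - x) ^ (d - i) := by
    have h := add_pow x (1 - x) i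
    rw [add_sub_cancel, one_pow] at h
    have h' : (1 - x) ^ (d - i) = (∑ u ∈ Finset.range (i + 1),
        x ^ u * (1 - x) ^ (i - u) * ((i.choose u : ℕ) : ℚ)) * (1 - x) ^ (d - i) := by
      rw [← h, one_mul]
    rw [h', Finset.sum_mul]
    symm
    refine Finset.sum_subset_zero_on_sdiff (Finset.range_mono (by omega)) ?_ ?_
    · intro u hu
      simp only [Finset.mem_sdiff, Finset.mem_range] at hu
      rw [Nat.choose_eq_zero_of_lt (by omega)]
      simp
    · intro u hu
      have hu := Finset.mem_range.mp hu
      rw [show d - u = i - u + (d - i) by omega, pow_add]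
      ring
  have hrefl (x : ℚ) : ∑ i ∈ Finset.range (d + 1), a i * x ^ (d - i) =
      -∑ i ∈ Finset.range (d + 1), a i * x ^ i := by
    rw [← Finset.sum_range_reflect, ← Finset.sum_neg_distrib]
    refine Finset.sum_congr rfl fun i hi => ?_
    have hi := Finset.mem_range.mp hi
    rw [show d + 1 - 1 - i = d - i by omega, hanti i (by omega), show d - (d - i) = i by omega]
    ring
  refine Polynomial.funext fun x => ?_
  simp only [eval_comp, eval_finsetSum, eval_mul, eval_C, eval_pow, eval_X, eval_sub, eval_one,
    eval_neg]
  -- Weighting relation u by x^u (1-x)^(d-u) assembles all the relations into one polynomial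
  -- identity.
  have h₁ : ∑ u ∈ Finset.range (d + 1), (∑ i ∈ Finset.range (d + 1),
      (((i.choose u : ℕ) : ℚ) + ((i.choose (d - u) : ℕ) : ℚ)) * a i) *
        (x ^ u * (1 - x) ^ (d - u)) = 0 :=
    Finset.sum_eq_zero fun u hu => by
      rw [hsh u (by have := Finset.mem_range.mp hu; omega), zero_mul]
  have h₂ (i : ℕ) (hi : i ≤ d) : ∑ u ∈ Finset.range (d + 1),
      ((i.choose (d - u) : ℕ) : ℚ) * (x ^ u * (1 - x) ^ (d - u)) = x ^ (d - i) := by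
    have h := hbin (1 - x) i hi
    rw [← Finset.sum_range_reflect, sub_sub_cancel] at h
    rw [← h]
    refine Finset.sum_congr rfl fun u hu => ?_
    have hu := Finset.mem_range.mp hu
    rw [show d + 1 - 1 - u = d - u by omega, show d - (d - u) = u by omega]
    ring
  have h₃ : ∑ i ∈ Finset.range (d + 1), a i * (1 - x) ^ (d - i) +
      ∑ i ∈ Finset.range (d + 1), a i * x ^ (d - i) = 0 := by
    rw [← h₁, ← Finset.sum_add_distrib]
    simp only [Finset.sum_mul]
    rw [Finset.sum_comm]
    refine Finset.sum_congr rfl fun i hi => ?_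
    have hi := Finset.mem_range.mp hi
    rw [← hbin x i (by omega), ← h₂ i (by omega), Finset.mul_sum, Finset.mul_sum,
      ← Finset.sum_add_distrib]
    refine Finset.sum_congr rfl fun u _ => ?_
    ring
  rw [hrefl, hrefl] at h₃
  linarith

end

/-! ### Linear functionals and generation of the quotient -/

open Finset in
/-- A `ℚ`-linear functional which kills `PZ_k` and one of `ζ(2j, k - 2j)`, `ζ(2j + 1, k - 2j - 1)`
for each `1 ≤ j ≤ n`, where `n = (k - 2) / 6`, kills all double zeta values of weight `k`. -/
theorem functional_doubleZeta_eq_zero {d n : ℕ} (hd : Even d) (hd₀ : 1 ≤ d) (hdn : d ≤ 6 * n + 5)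
    (hnd : 6 * n ≤ d) (ψ : ℝ →ₗ[ℚ] ℚ) (hψ : ∀ x ∈ PZ (d + 2), ψ x = 0)
    (hn : ∀ j, 1 ≤ j → j ≤ n →
      ψ (doubleZeta (2 * j) (d + 2 - 2 * j)) = 0 ∨
        ψ (doubleZeta (2 * j + 1) (d + 2 - (2 * j + 1))) = 0)
    {q p : ℕ} (hq : 2 ≤ q) (hp : 1 ≤ p) (hqp : q + p = d + 2) :
    ψ (doubleZeta q p) = 0 := by
  let b : ℕ → ℚ := fun i => ψ (doubleZeta (i + 1) (d - i + 1))
  -- Index 0 would be the divergent ζ(1, d+1); the value -a_d extends the stuffle antisymmetry to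
  -- the endpoints.
  let a : ℕ → ℚ := fun i => if i = 0 then -b d else b i
  have ha (i : ℕ) (hi : 1 ≤ i) : a i = b i := if_neg (by omega)
  have ha₀ : a 0 = -a d := by rw [ha d hd₀]; exact if_pos rfl
  have hzeta : ψ (zetaValue (d + 2)) = 0 :=
    hψ _ (Submodule.subset_span (Or.inl rfl))
  have hprod (u v : ℕ) (hu : 1 ≤ u) (hv : 1 ≤ v) (huv : u + v = d) :
      ψ (zetaValue (u + 1) * zetaValue (v + 1)) = 0 :=
    hψ _ (Submodule.subset_span (Or.inr ⟨u + 1, by omega, by omega, by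
      rw [show d + 2 - (u + 1) = v + 1 by omega]⟩))
  have hanti (i : ℕ) (hi : i ≤ d) : a (d - i) = -a i := by
    rcases Nat.eq_zero_or_pos i with rfl | hi₀
    · rw [ha₀, Nat.sub_zero, neg_neg]
    rcases hi.eq_or_lt with rfl | hid
    · rw [Nat.sub_self, ha₀]
    have h := hprod i (d - i) hi₀ (by omega) (by omega)
    rw [zetaValue_mul_eq_stuffle (by omega) (by omega),
      show i + 1 + (d - i + 1) = d + 2 by omega, map_add, map_add, hzeta, add_zero] at h
    rw [ha _ hi₀, ha _ (by omega)]
    simp only [b]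
    rw [show d - (d - i) = i by omega]
    linarith
  have hsum : ∑ i ∈ range (d + 1), a i + a d = 0 := by
    have h := hzeta
    rw [← sum_doubleZeta_eq_zetaValue hd₀, map_sum] at h
    rw [sum_range_succ', ha₀, neg_add_cancel_right, ← h]
    refine sum_congr rfl fun i hi => ?_
    have hi := mem_range.mp hi
    rw [ha _ (by omega)]
    simp only [b]
    rw [show d - (i + 1) + 1 = d - i by omega]
  have hsh (u : ℕ) (hu : u ≤ d) : ∑ i ∈ range (d + 1),
      (((i.choose u : ℕ) : ℚ) + ((i.choose (d - u) : ℕ) : ℚ)) * a i = 0 := by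
    simp only [add_mul, sum_add_distrib]
    rcases Nat.eq_zero_or_pos u with rfl | hu₀
    -- The relations u = 0 and u = d would involve ζ(1); the sum formula stands in for them.
    · rw [Nat.sub_zero, sum_choose_self_range]
      simpa using hsum
    rcases hu.eq_or_lt with rfl | hud
    · rw [Nat.sub_self, sum_choose_self_range, add_comm]
      simpa using hsum
    have h := hprod u (d - u) hu₀ (by omega) (by omega)
    rw [zetaValue_mul_eq_shuffle hu₀ (by omega), show u + (d - u) = d by omega, map_sum] at h
    rw [← sum_add_distrib, ← h]
    refine sum_congr rfl fun i hi => ?_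
    rcases Nat.eq_zero_or_pos i with rfl | hi₀
    · simp [Nat.choose_eq_zero_of_lt hu₀, Nat.choose_eq_zero_of_lt (by omega : 0 < d - u)]
    · rw [ha i hi₀, ← add_mul, ← Nat.cast_add, ← Nat.cast_add, ← nsmul_eq_mul, ← nsmul_eq_mul,
        map_nsmul]
  let P : Polynomial ℚ := ∑ i ∈ range (d + 1), Polynomial.C (a i) * Polynomial.X ^ i
  have hcoeff (i : ℕ) (hi : i ≤ d) : P.coeff i = a i := by
    simp only [P, Polynomial.finsetSum_coeff, Polynomial.coeff_C_mul_X_pow]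
    rw [sum_ite_eq, if_pos (by simp; omega)]
  have hP : P = 0 := by
    refine eq_zero_of_antisymm hd hdn ?_ ?_ (comp_one_sub_eq_neg hanti hsh) ?_
    · exact Polynomial.natDegree_sum_le_of_forall_le _ _ fun i hi =>
        (Polynomial.natDegree_C_mul_X_pow_le _ _).trans (by have := mem_range.mp hi; omega)
    · intro i hi
      rw [hcoeff i hi, hcoeff _ (by omega), hanti i hi]
    · intro j hj₁ hj₂
      rw [hcoeff _ (by omega), hcoeff _ (by omega), ha _ (by omega), ha _ (by omega)]
      refine (hn j hj₁ hj₂).imp (fun h => ?_) fun h => ?_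
      · rw [← h]
        simp only [b]
        congr 2 <;> omega
      · rw [← h]
        simp only [b]
        congr 2
        omega
  have h := hcoeff (q - 1) (by omega)
  rw [hP, Polynomial.coeff_zero, ha _ (by omega)] at h
  simp only [b] at h
  rwa [show q - 1 + 1 = q by omega, show d - (q - 1) + 1 = p by omega, eq_comm] at h

/-- Modulo `PZ_k`, the space `DZ_k` is spanned by one of `ζ(2j, k - 2j)`, `ζ(2j + 1, k - 2j - 1)`
for each `1 ≤ j ≤ (k - 2) / 6`. -/
theorem DZ_le_PZ_sup_span {k : ℕ} (hk_even : Even k) {ε : ℕ → ℕ}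
    (hε : ∀ j : ℕ, 1 ≤ j → j ≤ (k - 2) / 6 → ε j = 0 ∨ ε j = 1) :
    DZ k ≤ PZ k ⊔ Submodule.span ℚ {x : ℝ | ∃ j : ℕ, 1 ≤ j ∧ j ≤ (k - 2) / 6 ∧
      x = doubleZeta (2 * j + ε j) (k - 2 * j - ε j)} := by
  refine Submodule.span_le.mpr ?_
  rintro _ ⟨q, p, hq, hp, hqp, rfl⟩
  by_contra hne
  -- A vector outside a subspace is separated from it by a functional with values in `ℚ`.
  obtain ⟨ψ, hψ, hle⟩ := Submodule.exists_le_ker_of_notMem hne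
  obtain ⟨d, rfl⟩ : ∃ d, k = d + 2 := ⟨k - 2, by omega⟩
  have hd : Even d := by simpa [Nat.even_add] using hk_even
  refine hψ (functional_doubleZeta_eq_zero (n := d / 6) hd (by omega) (by omega) (by omega) ψ
    (fun x hx => hle (Submodule.mem_sup_left hx)) (fun j hj₁ hj₂ => ?_) hq hp hqp)
  have h : ψ (doubleZeta (2 * j + ε j) (d + 2 - 2 * j - ε j)) = 0 :=
    hle (Submodule.mem_sup_right (Submodule.subset_span ⟨j, hj₁, by omega, rfl⟩))
  rcases hε j hj₁ (by omega) with he | he <;> rw [he] at h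
  · exact Or.inl h
  · exact Or.inr h

theorem theorem1 (k : ℕ) (hk : 2 ≤ k) (hk_even : Even k)
    (ε : ℕ → ℕ) (hε : ∀ j : ℕ, 1 ≤ j → j ≤ (k - 2) / 6 → ε j = 0 ∨ ε j = 1) :
    Submodule.span ℚ
        {x : DM k | ∃ (j : ℕ) (h₁ : 1 ≤ j) (h₂ : j ≤ (k - 2) / 6),
          x = dmClass k (2 * j + ε j) (k - 2 * j - ε j)
            (by omega)
            (by have := hε j h₁ h₂; omega)
            (by have := hε j h₁ h₂; omega)} = ⊤ ∧
      Module.rank ℚ (DM k) ≤ (((k - 2) / 6 : ℕ) : Cardinal) := by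
  have hspan : Submodule.span ℚ
        {x : DM k | ∃ (j : ℕ) (h₁ : 1 ≤ j) (h₂ : j ≤ (k - 2) / 6),
          x = dmClass k (2 * j + ε j) (k - 2 * j - ε j)
            (by omega)
            (by have := hε j h₁ h₂; omega)
            (by have := hε j h₁ h₂; omega)} = ⊤ := by
    set S : Submodule ℚ (DM k) := Submodule.span ℚ _ with hS
    have hT : Submodule.span ℚ {x : ℝ | ∃ j : ℕ, 1 ≤ j ∧ j ≤ (k - 2) / 6 ∧
        x = doubleZeta (2 * j + ε j) (k - 2 * j - ε j)} ≤
        (S.comap ((PZ k).submoduleOf (DZ k)).mkQ).map (DZ k).subtype := by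
      refine Submodule.span_le.mpr ?_
      rintro _ ⟨j, h₁, h₂, rfl⟩
      have := hε j h₁ h₂
      exact ⟨⟨_, doubleZeta_mem_DZ (by omega) (by omega) (by omega)⟩,
        Submodule.subset_span ⟨j, h₁, h₂, rfl⟩, rfl⟩
    refine Submodule.eq_top_iff'.mpr fun x => ?_
    obtain ⟨⟨x, hx⟩, rfl⟩ := Submodule.mkQ_surjective _ x
    obtain ⟨y, hy, z, hz, hyz⟩ := Submodule.mem_sup.mp (DZ_le_PZ_sup_span hk_even hε hx)
    obtain ⟨z, hzS, rfl⟩ := hT hz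
    have hxz : ((PZ k).submoduleOf (DZ k)).mkQ ⟨x, hx⟩ = ((PZ k).submoduleOf (DZ k)).mkQ z := by
      refine (Submodule.Quotient.eq _).mpr (Submodule.mem_comap.mpr ?_)
      have : (DZ k).subtype (⟨x, hx⟩ - z) = y := by
        rw [map_sub, sub_eq_iff_eq_add]
        exact hyz.symm
      rwa [this]
    rw [hxz]
    exact hzS
  refine ⟨hspan, ?_⟩
  rw [← rank_top, ← hspan]
  refine (rank_span_le _).trans ?_
  refine (Cardinal.mk_le_mk_of_subset (t := Set.range fun j : Fin ((k - 2) / 6) =>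
    dmClass k (2 * (j + 1) + ε (j + 1)) (k - 2 * (j + 1) - ε (j + 1)) (by omega)
      (by have := hε (j + 1) (by omega) (by omega); omega)
      (by have := hε (j + 1) (by omega) (by omega); omega)) ?_).trans
    (Cardinal.mk_range_le.trans (Cardinal.mk_fin _).le)
  rintro _ ⟨j, h₁, h₂, rfl⟩
  obtain ⟨i, rfl⟩ := Nat.exists_eq_add_of_le' h₁
  exact ⟨⟨i, by omega⟩, rfl⟩
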